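/- For a real number $q>0$ with $q\neq 1$ and a polynomial $W(x,y)\in\mathbb{C}[x,y]$ put $$W^{\sigma_q}(x,y)=W\!\left(\frac{x+(q-1)y}{\sqrt q},\frac{x-y}{\sqrt q}\right).$$ Consider polynomials of the form $$W(x,y)=x^n+\sum_{i=d}^{n}A_i\,x^{n-i}y^i\in\mathbb{C}[x,y],\qquad A_d\neq 0,\quad 1\le d\le n. \tag{1}$$ A polynomial $W$ of the form (1) with $W^{\sigma_q}=-W$ is called a formal weight enumerator for $q$. It is said to be * of Type I if $q=2$ and $W\in\mathbb{C}[\,x^2+y^2,\ x^4-6x^2y^2+y^4\,]$; * of Type II if $q=2$ and $W\in\mathbb{C}[\,x^8+14x^4y^4+y^8,\ x^{12}-33x^8y^4-33x^4y^8+y^{12}\,]$; * of Type III if $q=3$ and $W\in\mathbb{C}[\,x^4+8xy^3,\ x^6-20x^3y^3-8y^6\,]$; * of Type IV if $q=4$ and $W\in\mathbb{C}[\,x^2+3y^2,\ x^3-9xy^2\,]$. **Theorem 1.1.** For all formal weight enumerators of Types I through IV of the form (1), $$\begin{aligned} (\text{Type I})\quad & d\le 2\left[\frac{n-4}{8}\right]+2,\\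 (\text{Type II})\quad & d\le 4\left[\frac{n-12}{24}\right]+4,\\ (\text{Type III})\quad & d\le 3\left[\frac{n-6}{12}\right]+3,\\ (\text{Type IV})\quad & d\le 2\left[\frac{n-3}{6}\right]+2, \end{aligned}$$ where $[x]$ denotes the greatest integer not exceeding $x\in\mathbb{R}$. -/

import Mathlib

open MvPolynomial

noncomputable section

namespace FormalWeight

/-- Polynomials in the two variables `x = X 0` and `y = X 1` over the complex numbers. -/
abbrev Poly : Type := MvPolynomial (Fin 2) ℂ

/-- The variable `x`. -/
abbrev x : Poly := X 0

/-- The variable `y`. -/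
abbrev y : Poly := X 1

/-- The linear substitution `W^σ(x, y) = W(a x + b y, c x + d y)` for `σ = (a b; c d)`. -/
def subst (σ : Matrix (Fin 2) (Fin 2) ℂ) (W : Poly) : Poly :=
  aeval ![C (σ 0 0) * x + C (σ 0 1) * y, C (σ 1 0) * x + C (σ 1 1) * y] W

/-- The MacWilliams transform `σ_q = (1 / √q) (1 q-1; 1 -1)`. -/
def macWilliams (q : ℝ) : Matrix (Fin 2) (Fin 2) ℂ :=
  (1 / (Real.sqrt q : ℂ)) • !![1, (q : ℂ) - 1; 1, -1]

/-- `W = x^n + ∑_{i=d}^n A_i x^{n-i} y^i` with complex `A_i` and `A_d ≠ 0`, where `1 ≤ d ≤ n`. -/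
def HasForm (W : Poly) (n d : ℕ) : Prop :=
  1 ≤ d ∧ d ≤ n ∧ ∃ A : ℕ → ℂ, A d ≠ 0 ∧
    W = x ^ n + ∑ i ∈ Finset.Icc d n, C (A i) * x ^ (n - i) * y ^ i

/-- `W` has the form above and changes sign under the MacWilliams transform for `q`. -/
def IsFormalWeightEnumerator (q : ℝ) (W : Poly) (n d : ℕ) : Prop :=
  HasForm W n d ∧ subst (macWilliams q) W = -W

/-- `W_{2,q} = x² + (q - 1) y²`. -/
def W₂ (q : ℝ) : Poly := x ^ 2 + C ((q : ℂ) - 1) * y ^ 2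

/-- `φ_4 = x⁴ - 6 x² y² + y⁴`. -/
def phi₄ : Poly := x ^ 4 - 6 * x ^ 2 * y ^ 2 + y ^ 4

/-- The weight enumerator of the extended Hamming code, `x⁸ + 14 x⁴ y⁴ + y⁸`. -/
def WH₈ : Poly := x ^ 8 + 14 * x ^ 4 * y ^ 4 + y ^ 8

/-- `W_12 = x¹² - 33 x⁸ y⁴ - 33 x⁴ y⁸ + y¹²`. -/
def W₁₂ : Poly := x ^ 12 - 33 * x ^ 8 * y ^ 4 - 33 * x ^ 4 * y ^ 8 + y ^ 12

/-- `W_4 = x⁴ + 8 x y³`. -/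
def W₄ : Poly := x ^ 4 + 8 * x * y ^ 3

/-- `ψ_6 = x⁶ - 20 x³ y³ - 8 y⁶`. -/
def psi₆ : Poly := x ^ 6 - 20 * x ^ 3 * y ^ 3 - 8 * y ^ 6

/-- `φ_3 = x³ - 9 x y²`. -/
def phi₃ : Poly := x ^ 3 - 9 * x * y ^ 2

/-- Type I: formal weight enumerators for `q = 2` in `ℂ[W_{2,2}, φ_4]`. -/
def IsTypeI (W : Poly) (n d : ℕ) : Prop :=
  IsFormalWeightEnumerator 2 W n d ∧ W ∈ Algebra.adjoin ℂ {W₂ 2, phi₄}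

/-- Type II: formal weight enumerators for `q = 2` in `ℂ[W_{H₈}, W_12]`. -/
def IsTypeII (W : Poly) (n d : ℕ) : Prop :=
  IsFormalWeightEnumerator 2 W n d ∧ W ∈ Algebra.adjoin ℂ {WH₈, W₁₂}

/-- Type III: formal weight enumerators for `q = 3` in `ℂ[W_4, ψ_6]`. -/
def IsTypeIII (W : Poly) (n d : ℕ) : Prop :=
  IsFormalWeightEnumerator 3 W n d ∧ W ∈ Algebra.adjoin ℂ {W₄, psi₆}

/-- Type IV: formal weight enumerators for `q = 4` in `ℂ[W_{2,4}, φ_3]`. -/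
def IsTypeIV (W : Poly) (n d : ℕ) : Prop :=
  IsFormalWeightEnumerator 4 W n d ∧ W ∈ Algebra.adjoin ℂ {W₂ 4, phi₃}

end FormalWeight

end

/-! A nonzero binary form cannot be divisible by linear forms, counted with multiplicity, in excess
of its degree. In each type `W` changes sign under the MacWilliams reflection `σ` and is fixed by `y
↦ ζ y`, with `ζ` a primitive `k`-th root of unity (`k` = 2, 4, 3, 2), so `k ∣ d`. The group
generated by `σ` and this diagonal map permutes lines. The orbit of `y` has `e + k + 1` = 4, 6, 4, 3
lines, and the orbit of the mirror of `σ` has `M` = 4, 12, 6, 3.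

Let `p` be the product of the orbit of `y` under the transposed group (`symbol`), normalised to be
fixed by the transpose of `σ`. By the chain rule (`diffOp_substHom`), `V = p(∂x, ∂y) W` still
changes sign under `σ` and is scaled by the diagonal map. Since `p` is divisible by `y`, it kills `x
^ n`, so `y ^ (d - k - 1) ∣ V`. Symmetry spreads this multiplicity over the orbit of `y`. The sign
change makes `V` vanish on the mirror (`mirror_dvd`), hence on the mirror's orbit. Counting lines
(`card_lines_le`) gives `M + (e + k + 1)(d - k - 1) ≤ n - (e + k + 1)`, that is, `M + (e + k + 1)(d
- k) ≤ n` (`degree_bound`). Dividing `d` by `k` yields the floor bounds. -/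

namespace FormalWeight

/-! ### Linear substitutions -/

/-- The linear substitution by `σ` as an algebra homomorphism. -/
noncomputable def substHom (σ : Matrix (Fin 2) (Fin 2) ℂ) : Poly →ₐ[ℂ] Poly :=
  aeval ![C (σ 0 0) * x + C (σ 0 1) * y, C (σ 1 0) * x + C (σ 1 1) * y]

theorem subst_eq_substHom (σ : Matrix (Fin 2) (Fin 2) ℂ) (W : Poly) :
    subst σ W = substHom σ W := rfl

@[simp] theorem substHom_x (σ : Matrix (Fin 2) (Fin 2) ℂ) :
    substHom σ (X 0) = C (σ 0 0) * x + C (σ 0 1) * y := by simp [substHom]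

@[simp] theorem substHom_y (σ : Matrix (Fin 2) (Fin 2) ℂ) :
    substHom σ (X 1) = C (σ 1 0) * x + C (σ 1 1) * y := by simp [substHom]

@[simp] theorem substHom_C (σ : Matrix (Fin 2) (Fin 2) ℂ) (a : ℂ) :
    substHom σ (C a) = C a := by simp [substHom]

theorem eval_substHom (σ : Matrix (Fin 2) (Fin 2) ℂ) (W : Poly) (v : Fin 2 → ℂ) :
    eval v (substHom σ W) = eval (σ.mulVec v) W := by
  induction W using MvPolynomial.induction_on with
  | C a => simp
  | add p q hp hq => simp [hp, hq]
  | mul_X p i hp =>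
    rw [map_mul, map_mul, map_mul, hp]
    congr 1
    fin_cases i <;> simp

/-! ### Constant coefficient differential operators -/

/-- The commutator of two derivations is a derivation, so it suffices that it vanishes on the
variables. Commutation is what makes `p ↦ p(∂x, ∂y)` multiplicative although the endomorphism
algebra is noncommutative. -/
theorem pderiv_comm (W : Poly) : pderiv 0 (pderiv 1 W) = pderiv 1 (pderiv 0 W) := by
  have h : ⁅(pderiv 0 : Derivation ℂ Poly Poly), (pderiv 1 : Derivation ℂ Poly Poly)⁆ = 0 := by
    apply derivation_ext
    intro i
    fin_cases i <;> simp [Derivation.commutator_apply, pderiv_X]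
  have := congrArg (fun D : Derivation ℂ Poly Poly => D W) h
  simpa [Derivation.commutator_apply, sub_eq_zero] using this

/-- The partial derivative as a linear endomorphism. -/
noncomputable def partialEnd (i : Fin 2) : Module.End ℂ Poly := (pderiv i : Derivation ℂ Poly Poly).toLinearMap

@[simp] theorem partialEnd_apply (i : Fin 2) (W : Poly) : partialEnd i W = pderiv i W := rfl

theorem partialEnd_commute : Commute (partialEnd 0) (partialEnd 1) :=
  LinearMap.ext pderiv_comm

/-- The assignment sending a monomial `x ^ a * y ^ b` to `∂x ^ a * ∂y ^ b`. -/
noncomputable def monomialEnd : Multiplicative (Fin 2 →₀ ℕ) →* Module.End ℂ Poly where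
  toFun m := partialEnd 0 ^ (m.toAdd 0) * partialEnd 1 ^ (m.toAdd 1)
  map_one' := by simp
  map_mul' m m' := by
    have h := (partialEnd_commute.pow_pow (m'.toAdd 0) (m.toAdd 1)).eq
    simp only [toAdd_mul, Finsupp.add_apply, pow_add]
    rw [mul_assoc, mul_assoc, ← mul_assoc (partialEnd 0 ^ (m'.toAdd 0)), h]
    simp only [mul_assoc]

/-- The differential operator `p(∂x, ∂y)` attached to a polynomial `p`. -/
noncomputable def diffOp : Poly →ₐ[ℂ] Module.End ℂ Poly := AddMonoidAlgebra.lift ℂ (Module.End ℂ Poly) _ monomialEnd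

theorem diffOp_monomial (m : Fin 2 →₀ ℕ) (a : ℂ) :
    diffOp (monomial m a) = a • (partialEnd 0 ^ (m 0) * partialEnd 1 ^ (m 1)) := by
  have : (monomial m a : Poly) = AddMonoidAlgebra.single m a := rfl
  rw [this, diffOp, AddMonoidAlgebra.lift_single]
  rfl

@[simp] theorem diffOp_X (i : Fin 2) : diffOp (X i) = partialEnd i := by
  rw [X, diffOp_monomial]
  fin_cases i <;> simp

/-- The chain rule for linear substitutions. -/
theorem pderiv_substHom (σ : Matrix (Fin 2) (Fin 2) ℂ) (W : Poly) (i : Fin 2) :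
    pderiv i (substHom σ W) =
      C (σ 0 i) * substHom σ (pderiv 0 W) + C (σ 1 i) * substHom σ (pderiv 1 W) := by
  induction W using MvPolynomial.induction_on with
  | C a => simp
  | add p q hp hq =>
    simp only [map_add, hp, hq]
    ring
  | mul_X p j hp =>
    simp only [map_mul, pderiv_mul, hp, map_add]
    fin_cases j <;> fin_cases i <;> simp [pderiv_X] <;> ring

/-- Constant coefficient operators and linear substitutions commute up to the transposed
substitution in the symbol. -/
theorem diffOp_substHom (σ : Matrix (Fin 2) (Fin 2) ℂ) (p W : Poly) :
    diffOp p (substHom σ W) = substHom σ (diffOp (substHom σ.transpose p) W) := by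
  induction p using MvPolynomial.induction_on generalizing W with
  | C a => simp [map_smul]
  | add p q hp hq => simp [hp, hq]
  | mul_X p i hp =>
    have key : pderiv i (substHom σ W) =
        substHom σ (diffOp (substHom σ.transpose (X i)) W) := by
      rw [pderiv_substHom]
      fin_cases i <;> simp [smul_eq_C_mul]
    simp only [map_mul, Module.End.mul_apply, diffOp_X, partialEnd_apply]
    rw [key, hp]

/-! ### Coefficients -/

/-- The exponent of `x ^ a * y ^ b`. -/
noncomputable def expo (a b : ℕ) : Fin 2 →₀ ℕ := Finsupp.single 0 a + Finsupp.single 1 b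

@[simp] theorem expo_zero (a b : ℕ) : expo a b 0 = a := by simp [expo]

@[simp] theorem expo_one (a b : ℕ) : expo a b 1 = b := by simp [expo]

theorem expo_inj {a b a' b' : ℕ} : expo a b = expo a' b' ↔ a = a' ∧ b = b' := by
  refine ⟨fun h => ⟨?_, ?_⟩, fun h => by rw [h.1, h.2]⟩
  · simpa using DFunLike.congr_fun h 0
  · simpa using DFunLike.congr_fun h 1

theorem eq_expo (m : Fin 2 →₀ ℕ) : m = expo (m 0) (m 1) := by
  ext i
  fin_cases i <;> simp

theorem monomial_expo (a b : ℕ) (c : ℂ) : monomial (expo a b) c = C c * x ^ a * y ^ b := by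
  rw [← mul_one c, ← C_mul_monomial, mul_one, mul_assoc, expo, ← one_mul (1 : ℂ),
    ← monomial_mul, X_pow_eq_monomial, X_pow_eq_monomial]

/-- Derivatives multiply shifted coefficients by nonzero numbers. -/
theorem exists_coeff_partialEnd_pow (i j a b : ℕ) : ∃ c : ℂ, c ≠ 0 ∧ ∀ W : Poly,
    coeff (expo a b) ((partialEnd 0 ^ i * partialEnd 1 ^ j) W) =
      c * coeff (expo (a + i) (b + j)) W := by
  induction i generalizing a with
  | zero =>
    induction j generalizing b with
    | zero => exact ⟨1, one_ne_zero, by simp⟩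
    | succ j ih =>
      obtain ⟨c, hc, h⟩ := ih (b + 1)
      refine ⟨c * (b + 1), mul_ne_zero hc (Nat.cast_add_one_ne_zero b), fun W => ?_⟩
      have e1 : expo a b + Finsupp.single 1 1 = expo a (b + 1) := by
        rw [expo, expo, add_assoc, ← Finsupp.single_add]
      have := h W
      simp only [pow_zero, one_mul, pow_succ', Module.End.mul_apply, partialEnd_apply] at this ⊢
      rw [coeff_pderiv, e1, this, expo_one, show b + 1 + j = b + (j + 1) by ring]
      ring
  | succ i ih =>
    obtain ⟨c, hc, h⟩ := ih (a + 1)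
    refine ⟨c * (a + 1), mul_ne_zero hc (Nat.cast_add_one_ne_zero a), fun W => ?_⟩
    have e1 : expo a b + Finsupp.single 0 1 = expo (a + 1) b := by
      rw [expo, expo, add_right_comm, ← Finsupp.single_add]
    have := h W
    simp only [pow_succ', Module.End.mul_apply, partialEnd_apply] at this ⊢
    rw [coeff_pderiv, e1, this, expo_zero, show a + 1 + i = a + (i + 1) by ring]
    ring

theorem y_pow_dvd {V : Poly} {r : ℕ} (h : ∀ a b, b < r → coeff (expo a b) V = 0) :
    y ^ r ∣ V := by
  rw [V.as_sum]
  refine Finset.dvd_sum fun m hm => ?_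
  rw [eq_expo m, monomial_expo]
  refine Dvd.dvd.mul_left (pow_dvd_pow _ ?_) _
  by_contra hlt
  rw [mem_support_iff, eq_expo m] at hm
  exact hm (h _ _ (not_le.mp hlt))

theorem isHomogeneous_partialEnd_pow {W : Poly} {n : ℕ} (h : W.IsHomogeneous n) (i j : ℕ) :
    ((partialEnd 0 ^ i * partialEnd 1 ^ j) W).IsHomogeneous (n - (i + j)) := by
  have key : ∀ (l : Fin 2) (t : ℕ) {m : ℕ} {U : Poly}, U.IsHomogeneous m →
      ((partialEnd l ^ t) U).IsHomogeneous (m - t) := by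
    intro l t
    induction t with
    | zero => intro m U hU; simpa using hU
    | succ t ih =>
      intro m U hU
      rw [pow_succ', Module.End.mul_apply, partialEnd_apply, ← Nat.sub_sub]
      exact (ih hU).pderiv
  rw [Module.End.mul_apply, add_comm, ← Nat.sub_sub]
  exact key 0 i (key 1 j h)

/-! ### Polynomials of the form `x ^ n + A_d x ^ (n - d) y ^ d + ⋯` -/

theorem HasForm.exists_coeff {W : Poly} {n d : ℕ} (h : HasForm W n d) :
    W.IsHomogeneous n ∧ coeff (expo n 0) W = 1 ∧ coeff (expo (n - d) d) W ≠ 0 ∧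
      ∀ a b, 1 ≤ b → b < d → coeff (expo a b) W = 0 := by
  obtain ⟨h1, hn, A, hA, rfl⟩ := h
  have hx : (x ^ n : Poly) = monomial (expo n 0) 1 := by simp [monomial_expo]
  have hcoeff : ∀ a b, coeff (expo a b) (x ^ n + ∑ i ∈ Finset.Icc d n,
      C (A i) * x ^ (n - i) * y ^ i : Poly) = (if n = a ∧ 0 = b then 1 else 0) +
      ∑ i ∈ Finset.Icc d n, if n - i = a ∧ i = b then A i else 0 := by
    intro a b
    simp only [hx, ← monomial_expo, coeff_add, coeff_sum, coeff_monomial, expo_inj]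
  refine ⟨?_, ?_, ?_, ?_⟩
  · refine (isHomogeneous_X_pow _ _).add (IsHomogeneous.sum _ _ _ fun i hi => ?_)
    have hi' := (Finset.mem_Icc.mp hi).2
    have := (((isHomogeneous_C (Fin 2) (A i)).mul (isHomogeneous_X_pow (0 : Fin 2) (n - i))).mul
      (isHomogeneous_X_pow (1 : Fin 2) i))
    rwa [show 0 + (n - i) + i = n by omega] at this
  · rw [hcoeff, Finset.sum_eq_zero]
    · simp
    · intro i hi
      have := (Finset.mem_Icc.mp hi).1
      rw [if_neg (by omega)]
  · rw [hcoeff, if_neg (by omega), zero_add, Finset.sum_eq_single d]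
    · simpa using hA
    · intro i _ hi
      rw [if_neg (by tauto)]
    · intro hd
      exact absurd (Finset.mem_Icc.mpr ⟨le_rfl, hn⟩) hd
  · intro a b hb hbd
    rw [hcoeff, if_neg (by omega), zero_add]
    refine Finset.sum_eq_zero fun i hi => ?_
    have := (Finset.mem_Icc.mp hi).1
    rw [if_neg (by omega)]

/-! ### Products of linear forms -/

theorem isRelPrime_x_y : IsRelPrime (x : Poly) y := by
  have hirr : Irreducible (x : Poly) := (X_prime (i := (0 : Fin 2))).irreducible
  rw [hirr.isRelPrime_iff_not_dvd, X_dvd_X]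
  decide

/-- The linear form vanishing at `(c, 1)`. -/
noncomputable def lineForm (c : ℂ) : Poly := x - C c * y

theorem isRelPrime_y_lineForm (c : ℂ) : IsRelPrime y (lineForm c) := by
  intro f hy hl
  refine isRelPrime_x_y ?_ hy
  have := dvd_add hl (hy.mul_left (C c))
  rwa [lineForm, sub_add_cancel] at this

theorem isRelPrime_lineForm {c c' : ℂ} (h : c ≠ c') : IsRelPrime (lineForm c) (lineForm c') := by
  intro f h1 h2
  have hy : f ∣ y := by
    have h3 : f ∣ C (c' - c) * y := by
      have := dvd_sub h1 h2
      rwa [lineForm, lineForm, show x - C c * y - (x - C c' * y) = C (c' - c) * y by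
        rw [C_sub]; ring] at this
    have hu : IsUnit (C (c' - c) : Poly) :=
      (isUnit_iff_ne_zero.mpr (sub_ne_zero.mpr h.symm)).map C
    exact (hu.dvd_mul_left).mp h3
  exact isRelPrime_y_lineForm c hy h1

theorem isHomogeneous_lineForm (c : ℂ) : (lineForm c).IsHomogeneous 1 := by
  have := (isHomogeneous_X ℂ (0 : Fin 2)).sub
    ((isHomogeneous_C (Fin 2) c).mul (isHomogeneous_X ℂ (1 : Fin 2)))
  simpa [lineForm] using this

/-- The diagonal substitution `y ↦ ζ y`. -/
def scaleY (ζ : ℂ) : Matrix (Fin 2) (Fin 2) ℂ := !![1, 0; 0, ζ]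

theorem substHom_scaleY_lineForm (ζ c : ℂ) :
    substHom (scaleY ζ) (lineForm c) = lineForm (c * ζ) := by
  simp [lineForm, scaleY, mul_assoc]

section Divisors

variable {V : Poly} {ζ : ℂ}

/-- Divisibility `substHom (scaleY ζ) V ∣ V` is assumed instead of invariance because the
differentiated polynomial is only fixed up to a scalar. -/
theorem lineForm_mul_pow_dvd (hV : substHom (scaleY ζ) V ∣ V) {c : ℂ} {r : ℕ}
    (h : lineForm c ^ r ∣ V) (j : ℕ) : lineForm (c * ζ ^ j) ^ r ∣ V := by
  induction j with
  | zero => simpa using h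
  | succ j ih =>
    have := (map_dvd (substHom (scaleY ζ)) ih).trans hV
    rwa [map_pow, substHom_scaleY_lineForm, mul_assoc, ← pow_succ] at this

/-- The number of lines dividing `V`, counted with multiplicity, is at most its degree. -/
theorem card_lines_le {k : ℕ} (hk : 0 < k) (hζ : IsPrimitiveRoot ζ k) (hV0 : V ≠ 0)
    (hV : substHom (scaleY ζ) V ∣ V) {m : ℕ} (c : Fin m → ℂ) (e : Fin m → ℕ)
    (hc0 : ∀ i, c i ≠ 0) (hinj : Function.Injective fun i => c i ^ k)
    (hdvd : ∀ i, lineForm (c i) ^ e i ∣ V) {a b : ℕ} (hy : y ^ a ∣ V)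
    (hx : lineForm 0 ^ b ∣ V) : a + b + k * ∑ i, e i ≤ V.totalDegree := by
  set P : Poly := ∏ p : Fin m × Fin k, lineForm (c p.1 * ζ ^ (p.2 : ℕ)) ^ e p.1 with hP
  have hne : ∀ p q : Fin m × Fin k, p ≠ q →
      c p.1 * ζ ^ (p.2 : ℕ) ≠ c q.1 * ζ ^ (q.2 : ℕ) := by
    rintro ⟨i, s⟩ ⟨j, t⟩ hpq heq
    apply hpq
    -- Raising to the power `k` removes the factor `ζ ^ s`, so `c ^ k` labels the orbit of the line
    -- under the diagonal map.
    have hij : i = j := by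
      apply hinj
      have := congrArg (· ^ k) heq
      simpa [mul_pow, ← pow_mul, mul_comm _ k, pow_mul ζ k, hζ.pow_eq_one] using this
    subst hij
    have := mul_left_cancel₀ (hc0 i) heq
    rw [Prod.mk.injEq]
    exact ⟨rfl, Fin.ext (hζ.pow_inj s.2 t.2 this)⟩
  have hPV : P ∣ V := by
    refine Fintype.prod_dvd_of_isRelPrime (fun p q hpq => ?_) fun p => ?_
    · exact (isRelPrime_lineForm (hne p q hpq)).pow
    · exact lineForm_mul_pow_dvd hV (hdvd p.1) _
  have hζ0 : ζ ≠ 0 := hζ.ne_zero hk.ne'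
  have hxP : IsRelPrime (lineForm 0 ^ b) P :=
    IsRelPrime.prod_right fun p _ => (isRelPrime_lineForm
      (mul_ne_zero (hc0 p.1) (pow_ne_zero _ hζ0)).symm).pow
  have hyP : IsRelPrime (y ^ a) (lineForm 0 ^ b * P) :=
    ((isRelPrime_y_lineForm 0).pow).mul_right
      (IsRelPrime.prod_right fun p _ => (isRelPrime_y_lineForm _).pow)
  have hall : y ^ a * (lineForm 0 ^ b * P) ∣ V := hyP.mul_dvd hy (hxP.mul_dvd hx hPV)
  have hhom : (y ^ a * (lineForm 0 ^ b * P)).IsHomogeneous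
      (a + (1 * b + ∑ p : Fin m × Fin k, 1 * e p.1)) :=
    (isHomogeneous_X_pow _ _).mul (((isHomogeneous_lineForm 0).pow b).mul
      (IsHomogeneous.prod _ _ _ fun p _ => (isHomogeneous_lineForm _).pow _))
  have hdeg := hhom.totalDegree fun h0 => hV0 (zero_dvd_iff.mp (h0 ▸ hall))
  have := totalDegree_le_of_dvd_of_isDomain hall hV0
  rw [hdeg, Fintype.sum_prod_type] at this
  simp only [one_mul, Finset.sum_const, Finset.card_univ, Fintype.card_fin, smul_eq_mul,
    ← Finset.mul_sum] at this
  omega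

end Divisors

/-! ### The degree bound obtained from a differential operator -/

theorem coeff_substHom_scaleY (ζ : ℂ) (W : Poly) (a b : ℕ) :
    coeff (expo a b) (substHom (scaleY ζ) W) = ζ ^ b * coeff (expo a b) W := by
  induction W using MvPolynomial.induction_on' with
  | monomial m c =>
    have h : substHom (scaleY ζ) (monomial m c) = monomial m (ζ ^ m 1 * c) := by
      rw [eq_expo m, monomial_expo, monomial_expo]
      simp [scaleY, mul_pow]
      ring
    rw [h, coeff_monomial, coeff_monomial]
    split_ifs with hm
    · rw [hm, expo_one]
    · simp
  | add p q hp hq => simp [hp, hq, mul_add]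

/-- The nonzero coefficient of `x ^ (n - d) y ^ d` is multiplied by `ζ ^ d`, which must therefore be
1. -/
theorem HasForm.dvd_of_scaleY {W : Poly} {n d k : ℕ} {ζ : ℂ} (h : HasForm W n d)
    (hζ : IsPrimitiveRoot ζ k) (hW : substHom (scaleY ζ) W = W) : k ∣ d := by
  obtain ⟨-, -, hA, -⟩ := h.exists_coeff
  have := coeff_substHom_scaleY ζ W (n - d) d
  rw [hW] at this
  exact hζ.dvd_of_pow_eq_one d (mul_right_cancel₀ hA (by rw [one_mul]; exact this.symm))

/-- The symbol `α x ^ (e + k) y - x ^ e y ^ (k + 1)`. -/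
noncomputable def symbol (α : ℂ) (e k : ℕ) : Poly := C α * x ^ (e + k) * y - x ^ e * y ^ (k + 1)

theorem diffOp_symbol (α : ℂ) (e k : ℕ) (W : Poly) :
    diffOp (symbol α e k) W = α • (partialEnd 0 ^ (e + k) * partialEnd 1 ^ 1) W -
      (partialEnd 0 ^ e * partialEnd 1 ^ (k + 1)) W := by
  have h : symbol α e k = α • (x ^ (e + k) * y) - x ^ e * y ^ (k + 1) := by
    rw [symbol, smul_eq_C_mul, mul_assoc]
  rw [h]
  simp only [map_sub, map_smul, map_mul, map_pow, diffOp_X, pow_one, LinearMap.sub_apply,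
    LinearMap.smul_apply]

/-- The hypothesis `hlines` is the line count for the group at hand. It is applied to the derivative
of `W` along the invariant symbol. The condition `d + e ≤ n` ensures that this derivative does not
vanish. -/
theorem degree_bound {σ : Matrix (Fin 2) (Fin 2) ℂ} {ζ α : ℂ} {k e M n d : ℕ} {W : Poly}
    (hk : 0 < k) (hζ : IsPrimitiveRoot ζ k)
    (hp : substHom σ.transpose (symbol α e k) = symbol α e k)
    (hlines : ∀ (V : Poly) (r : ℕ), V ≠ 0 → substHom σ V = -V → substHom (scaleY ζ) V ∣ V →
      y ^ r ∣ V → M + (e + k + 1) * r ≤ V.totalDegree)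
    (hW : HasForm W n d) (hWσ : substHom σ W = -W) (hWζ : substHom (scaleY ζ) W = W)
    (hde : d + e ≤ n) : M + (e + k + 1) * (d - k) ≤ n := by
  have hkd := hW.dvd_of_scaleY hζ hWζ
  have hd1 := hW.1
  obtain ⟨hhom, hlead, hA, hzero⟩ := hW.exists_coeff
  -- For `d ≤ k` the truncated `d - k` is 0 and only the `M` mirror lines are needed: the count is
  -- applied to `W` itself with `r = 0`.
  obtain hle | hlt := le_or_gt d k
  · have hW0 : W ≠ 0 := by
      rintro rfl
      simp at hlead
    have := hlines W 0 hW0 hWσ hWζ.dvd (by simp)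
    rw [hhom.totalDegree hW0] at this
    rw [Nat.sub_eq_zero_of_le hle]
    simpa using this
  · set V := diffOp (symbol α e k) W with hV
    have hVσ : substHom σ V = -V := by
      have := diffOp_substHom σ (symbol α e k) W
      rw [hp, hWσ, map_neg] at this
      exact this.symm
    have hVζ : substHom (scaleY ζ) V ∣ V := by
      -- Both `y`-exponents in the symbol, 1 and `k + 1`, are congruent to 1 modulo `k`.
      have hsym : substHom (scaleY ζ).transpose (symbol α e k) = ζ • symbol α e k := by
        have hζ' : ζ ^ (k + 1) = ζ := by rw [pow_succ, hζ.pow_eq_one, one_mul]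
        rw [symbol, smul_eq_C_mul]
        simp only [scaleY, map_sub, map_mul, map_pow, substHom_C, substHom_x, substHom_y]
        simp [mul_pow, ← C_pow, hζ']
        ring
      have := diffOp_substHom (scaleY ζ) (symbol α e k) W
      rw [hWζ, hsym, map_smul, LinearMap.smul_apply, map_smul, smul_eq_C_mul] at this
      exact Dvd.intro_left _ this.symm
    have hVhom : V.IsHomogeneous (n - (e + k + 1)) := by
      rw [hV, diffOp_symbol, smul_eq_C_mul]
      have h2 := isHomogeneous_partialEnd_pow hhom e (k + 1)
      have h1 := (isHomogeneous_C (Fin 2) α).mul (isHomogeneous_partialEnd_pow hhom (e + k) 1)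
      rw [zero_add] at h1
      exact h1.sub h2
    -- For `b < d - k - 1` the coefficients of `W` involved have `y`-exponents `b + 1` and `b + k +
    -- 1`, both in the gap from 1 to `d - 1`.
    have hVy : y ^ (d - k - 1) ∣ V := by
      refine y_pow_dvd fun a b hb => ?_
      obtain ⟨c₁, -, h₁⟩ := exists_coeff_partialEnd_pow (e + k) 1 a b
      obtain ⟨c₂, -, h₂⟩ := exists_coeff_partialEnd_pow e (k + 1) a b
      rw [hV, diffOp_symbol, coeff_sub, coeff_smul, h₁, h₂,
        hzero _ _ (by omega) (by omega), hzero _ _ (by omega) (by omega)]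
      simp
    -- At `x ^ (n - d - e) y ^ (d - k - 1)` the first term of the symbol meets the gap (exponent `d
    -- - k`), while the second reaches exactly the coefficient `A_d`.
    have hV0 : V ≠ 0 := by
      intro h0
      obtain ⟨c₁, -, h₁⟩ := exists_coeff_partialEnd_pow (e + k) 1 (n - d - e) (d - k - 1)
      obtain ⟨c₂, hc₂, h₂⟩ := exists_coeff_partialEnd_pow e (k + 1) (n - d - e) (d - k - 1)
      have hc : coeff (expo (n - d - e) (d - k - 1)) V = 0 := by rw [h0, coeff_zero]
      rw [hV, diffOp_symbol, coeff_sub, coeff_smul, h₁, h₂,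
        hzero _ _ (by omega) (by omega), show n - d - e + e = n - d by omega,
        show d - k - 1 + (k + 1) = d by omega] at hc
      simp [hc₂, hA] at hc
    have := hlines V _ hV0 hVσ hVζ hVy
    rw [hVhom.totalDegree hV0] at this
    -- The operator lowers the degree by `e + k + 1`, one for each line of the orbit; this turns the
    -- multiplicity `d - k - 1` into `d - k` in the bound.
    obtain ⟨t, ht⟩ : ∃ t, d = k + 1 + t := ⟨d - k - 1, by omega⟩
    rw [show d - k - 1 = t by omega] at this
    rw [show d - k = t + 1 by omega, mul_add]
    omega

/-! ### The MacWilliams reflection -/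

/-- The MacWilliams transform written in terms of a square root `s` of `q`. -/
noncomputable def reflection (s : ℂ) : Matrix (Fin 2) (Fin 2) ℂ :=
  (1 / s) • !![1, s ^ 2 - 1; 1, -1]

theorem macWilliams_eq_reflection {q : ℝ} (hq : 0 ≤ q) :
    macWilliams q = reflection (Real.sqrt q : ℂ) := by
  rw [macWilliams, reflection, ← Complex.ofReal_pow, Real.sq_sqrt hq]

section Reflection

variable {s : ℂ} {V : Poly}

theorem substHom_reflection_y (s : ℂ) :
    substHom (reflection s) y = C (1 / s) * lineForm 1 := by
  simp [reflection, lineForm]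
  ring

/-- On the roots of linear forms the reflection acts as the Möbius map `c ↦ (c + s² - 1) / (c - 1)`.
The excluded root 1 is sent to infinity, that is, to the line `y`. -/
theorem substHom_reflection_lineForm {c : ℂ} (hc : c ≠ 1) :
    substHom (reflection s) (lineForm c) =
      C ((1 - c) / s) * lineForm ((c + s ^ 2 - 1) / (c - 1)) := by
  have hc' : c - 1 ≠ 0 := sub_ne_zero.mpr hc
  have h : (s ^ 2 - 1) / s + c / s = -((1 - c) / s * ((c + s ^ 2 - 1) / (c - 1))) := by
    field_simp
    ring
  have e1 : substHom (reflection s) (lineForm c) =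
      C ((1 - c) / s) * x + C ((s ^ 2 - 1) / s + c / s) * y := by
    simp [lineForm, reflection, div_eq_mul_inv]
    ring
  rw [e1, h, lineForm, C_neg, C_mul]
  ring

theorem dvd_of_substHom_dvd_neg (hV : substHom (reflection s) V = -V) {a : ℂ}
    {f g : Poly} (hf : substHom (reflection s) f = C a * g) {r : ℕ} (h : f ^ r ∣ V) :
    g ^ r ∣ V := by
  have h1 := map_dvd (substHom (reflection s)) h
  rw [hV, map_pow, hf, mul_pow, dvd_neg] at h1
  exact dvd_of_mul_left_dvd h1

theorem lineForm_one_dvd (hV : substHom (reflection s) V = -V) {r : ℕ}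
    (h : y ^ r ∣ V) : lineForm 1 ^ r ∣ V :=
  dvd_of_substHom_dvd_neg hV (substHom_reflection_y s) h

theorem lineForm_dvd_of_lineForm_dvd (hV : substHom (reflection s) V = -V)
    {c c' : ℂ} (hc : c ≠ 1) (hc' : c' * (c - 1) = c + s ^ 2 - 1) {r : ℕ}
    (h : lineForm c ^ r ∣ V) : lineForm c' ^ r ∣ V := by
  have hc0 : c - 1 ≠ 0 := sub_ne_zero.mpr hc
  rw [eq_div_of_mul_eq hc0 hc']
  exact dvd_of_substHom_dvd_neg hV (substHom_reflection_lineForm hc) h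

/-- A polynomial that changes sign under the reflection vanishes on the mirror. -/
theorem mirror_dvd (hs : s ≠ 0) (hV : substHom (reflection s) V = -V) :
    lineForm (s + 1) ∣ V := by
  -- The points of the line through `(s + 1, 1)` are fixed, so the substitution is the identity
  -- modulo its linear form. For `V` this makes `-2 V` divisible by that form.
  have key : ∀ U : Poly, lineForm (s + 1) ∣ substHom (reflection s) U - U := by
    intro U
    induction U using MvPolynomial.induction_on with
    | C a => simp
    | add p q hp hq =>
      rw [map_add, add_sub_add_comm]
      exact dvd_add hp hq
    | mul_X p i hp =>
      have hX : lineForm (s + 1) ∣ substHom (reflection s) (X i) - X i := by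
        fin_cases i
        · refine ⟨C ((1 - s) / s), ?_⟩
          have e1 : (C (1 / s) - 1 : Poly) = C ((1 - s) / s) := by
            rw [← C_1, ← C_sub]; congr 1; field_simp
          have e2 : (C ((s ^ 2 - 1) / s) : Poly) = -(C ((1 - s) / s) * C (s + 1)) := by
            rw [← C_mul, ← C_neg]; congr 1; field_simp; ring
          have e3 : substHom (reflection s) x - x =
              (C (1 / s) - 1) * x + C ((s ^ 2 - 1) / s) * y := by
            simp [reflection, div_eq_mul_inv]
            ring
          refine e3.trans ?_
          rw [e1, e2, lineForm]
          ring
        · refine ⟨C (1 / s), ?_⟩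
          have e1 : (C (1 / s) * C (s + 1) : Poly) = 1 + C (1 / s) := by
            rw [← C_mul, ← C_1, ← C_add]; congr 1; field_simp
          have e3 : substHom (reflection s) y - y = C (1 / s) * x - (1 + C (1 / s)) * y := by
            simp [reflection]
            ring
          refine e3.trans ?_
          rw [← e1, lineForm]
          ring
      have : substHom (reflection s) (p * X i) - p * X i =
          (substHom (reflection s) p - p) * substHom (reflection s) (X i) +
            p * (substHom (reflection s) (X i) - X i) := by
        rw [map_mul]
        ring
      rw [this]
      exact dvd_add (hp.mul_right _) (hX.mul_left _)
  have h := key V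
  rw [hV, show -V - V = C (-2) * V by rw [C_neg, show (C 2 : Poly) = 2 from rfl]; ring] at h
  have hu : IsUnit (C (-2) : Poly) := (isUnit_iff_ne_zero.mpr (by norm_num)).map C
  exact hu.dvd_mul_left.mp h

end Reflection

/-! ### The four types -/

theorem substHom_reflection_transpose_x (s : ℂ) :
    substHom (reflection s).transpose x = C (1 / s) * (x + y) := by
  simp [reflection, Matrix.transpose_apply]
  ring

theorem substHom_reflection_transpose_y (s : ℂ) :
    substHom (reflection s).transpose y = C (1 / s) * (C (s ^ 2 - 1) * x - y) := by
  simp [reflection, Matrix.transpose_apply]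
  ring

/-- The symbol is homogeneous of degree `e + k + 1`, so the factors `1 / s` collect into `1 / N`,
leaving an identity free of denominators. -/
theorem substHom_transpose_symbol {s α N : ℂ} {e k : ℕ} (hN : N = s ^ (e + k + 1)) (hs : s ≠ 0)
    (h : C α * (x + y) ^ (e + k) * (C (s ^ 2 - 1) * x - y) -
      (x + y) ^ e * (C (s ^ 2 - 1) * x - y) ^ (k + 1) = C N * symbol α e k) :
    substHom (reflection s).transpose (symbol α e k) = symbol α e k := by
  have h1 : (C (1 / s) ^ (e + k + 1) * C N : Poly) = 1 := by
    rw [← C_pow, ← C_mul, hN, ← mul_pow, one_div_mul_cancel hs, one_pow, C_1]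
  calc substHom (reflection s).transpose (symbol α e k)
      = C (1 / s) ^ (e + k + 1) * (C α * (x + y) ^ (e + k) * (C (s ^ 2 - 1) * x - y) -
          (x + y) ^ e * (C (s ^ 2 - 1) * x - y) ^ (k + 1)) := by
        simp only [symbol, map_sub, map_mul, map_pow, substHom_C,
          substHom_reflection_transpose_x, substHom_reflection_transpose_y, mul_pow]
        generalize (C (s ^ 2 - 1) : Poly) = q
        ring
    _ = symbol α e k := by rw [h, ← mul_assoc, h1, one_mul]

/-! ### Invariance of the four symbols, and exclusion of `d = n` for `q = 2` -/

theorem symbol_one_two (s : ℂ) (hs : s ^ 2 = 2) :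
    substHom (reflection s).transpose (symbol 1 1 2) = symbol 1 1 2 := by
  refine substHom_transpose_symbol (N := 4) (by linear_combination -(s ^ 2 + 2) * hs)
    (by rintro rfl; norm_num at hs) ?_
  rw [hs, symbol, show (C 4 : Poly) = 4 from rfl, show (2 - 1 : ℂ) = 1 by norm_num, C_1]
  ring

theorem symbol_one_four (s : ℂ) (hs : s ^ 2 = 2) :
    substHom (reflection s).transpose (symbol 1 1 4) = symbol 1 1 4 := by
  refine substHom_transpose_symbol (N := 8)
    (by linear_combination -(s ^ 4 + 2 * s ^ 2 + 4) * hs) (by rintro rfl; norm_num at hs) ?_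
  rw [hs, symbol, show (C 8 : Poly) = 8 from rfl, show (2 - 1 : ℂ) = 1 by norm_num, C_1]
  ring

theorem symbol_zero_three (s : ℂ) (hs : s ^ 2 = 3) :
    substHom (reflection s).transpose (symbol 8 0 3) = symbol 8 0 3 := by
  refine substHom_transpose_symbol (N := 9) (by linear_combination -(s ^ 2 + 3) * hs)
    (by rintro rfl; norm_num at hs) ?_
  rw [hs, symbol, show (C 9 : Poly) = 9 from rfl, show (C 8 : Poly) = 8 from rfl,
    show (3 - 1 : ℂ) = 2 by norm_num, show (C 2 : Poly) = 2 from rfl]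
  ring

theorem symbol_zero_two :
    substHom (reflection 2).transpose (symbol 9 0 2) = symbol 9 0 2 := by
  refine substHom_transpose_symbol (N := 8) (by norm_num) two_ne_zero ?_
  rw [symbol, show (C 8 : Poly) = 8 from rfl, show (C 9 : Poly) = 9 from rfl,
    show (2 ^ 2 - 1 : ℂ) = 3 by norm_num, show (C 3 : Poly) = 3 from rfl]
  ring

/-- In the self-dual binary case `x ^ n + A y ^ n` does not change sign. -/
theorem not_substHom_eq_neg {s : ℂ} (hs : s ^ 2 = 2) {W : Poly} {m : ℕ}
    (hform : HasForm W (2 * m) (2 * m)) : substHom (reflection s) W ≠ -W := by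
  intro hW
  obtain ⟨hm, -, A, -, rfl⟩ := hform
  have hpow : (1 / s) ^ (2 * m) = 1 / 2 ^ m := by rw [pow_mul, div_pow, hs, div_pow]; simp
  have hpow' : (-(1 / s)) ^ (2 * m) = 1 / 2 ^ m := by rw [Even.neg_pow (even_two_mul m), hpow]
  have h0 : 2 * m ≠ 0 := by omega
  have ev : ∀ v : Fin 2 → ℂ, (1 / s * (v 0 + v 1)) ^ (2 * m) + A (2 * m) *
      (1 / s * (v 0 - v 1)) ^ (2 * m) = -(v 0 ^ (2 * m) + A (2 * m) * v 1 ^ (2 * m)) := by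
    intro v
    have := congrArg (eval v) hW
    simp only [Finset.Icc_self, Finset.sum_singleton, Nat.sub_self] at this
    rw [eval_substHom] at this
    simp [reflection, dotProduct, Fin.sum_univ_two, hs] at this
    convert this using 3 <;> ring_nf
  -- Since the degree is even, the left sides at `(1, 0)` and `(0, 1)` agree, which forces `A = 1`;
  -- then `2 / 2 ^ m = -1`, impossible by sign.
  have h1 := ev ![1, 0]
  have h2 := ev ![0, 1]
  simp only [Matrix.cons_val_zero, Matrix.cons_val_one, add_zero, zero_add, sub_zero, zero_sub,
    mul_one, mul_neg, hpow, hpow', one_pow, zero_pow h0, mul_zero] at h1 h2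
  have hA : A (2 * m) = 1 := by linear_combination h2 - h1
  rw [hA] at h1
  have h3 : (2 : ℂ) = -(2 : ℂ) ^ m := by
    have : (2 : ℂ) ^ m ≠ 0 := pow_ne_zero m two_ne_zero
    field_simp at h1
    linear_combination h1
  have h4 : (2 : ℝ) = -(2 : ℝ) ^ m := by exact_mod_cast h3
  have : (0 : ℝ) < 2 ^ m := by positivity
  linarith

/-! ### Orbits of lines for the four groups -/

theorem ne_of_sq_eq_two {s : ℂ} (hs : s ^ 2 = 2) (q : ℚ) : s ≠ q := by
  rintro rfl
  have h : q ^ 2 = 2 := by exact_mod_cast hs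
  refine (Nat.Prime.irrational_sqrt Nat.prime_two) ⟨|q|, ?_⟩
  rw [eq_comm, Real.sqrt_eq_iff_eq_sq (by positivity) (by positivity)]
  rw [Rat.cast_abs, sq_abs]
  exact_mod_cast h.symm

section Lines

variable {s : ℂ} {V : Poly} {r : ℕ}

theorem lineForm_zero_dvd (hs : s ^ 2 = 2) (hV : substHom (reflection s) V = -V)
    (h : lineForm (-1) ^ r ∣ V) : lineForm 0 ^ r ∣ V :=
  lineForm_dvd_of_lineForm_dvd hV (by norm_num) (by rw [hs]; norm_num) h

theorem conjugate_mirror_dvd (hs : s ^ 2 = 2) (hV : substHom (reflection s) V = -V)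
    (h : lineForm (-(s + 1)) ∣ V) : lineForm (s - 1) ∣ V := by
  rw [← pow_one (lineForm _)] at h ⊢
  refine lineForm_dvd_of_lineForm_dvd hV (fun h => ?_) ?_ h
  · exact ne_of_sq_eq_two hs (-2) (by push_cast; linear_combination -h)
  · linear_combination -2 * hs

/-- The orbit of `y` consists of `y`, `x`, `x ± y`, and the mirror orbit has roots `±(s + 1)`, `±(s
- 1)`. -/
theorem lines_typeI (hs : s ^ 2 = 2) (hV0 : V ≠ 0) (hV : substHom (reflection s) V = -V)
    (hVζ : substHom (scaleY (-1)) V ∣ V) (hy : y ^ r ∣ V) :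
    4 + (1 + 2 + 1) * r ≤ V.totalDegree := by
  have hζ : IsPrimitiveRoot (-1 : ℂ) 2 := IsPrimitiveRoot.neg_one 0 (by norm_num)
  have hs0 : s ≠ 0 := by exact_mod_cast ne_of_sq_eq_two hs 0
  have h1 := lineForm_one_dvd hV hy
  have h2 : lineForm (-1) ^ r ∣ V := by simpa using lineForm_mul_pow_dvd hVζ h1 1
  have h3 := mirror_dvd hs0 hV
  have h4 : lineForm (-(s + 1)) ∣ V := by
    have := lineForm_mul_pow_dvd hVζ (r := 1) (by rwa [pow_one]) 1
    rwa [pow_one, pow_one, mul_neg_one] at this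
  have h5 := conjugate_mirror_dvd hs hV h4
  have hp1 : s ≠ 1 := by exact_mod_cast ne_of_sq_eq_two hs 1
  have hm1 : s ≠ -1 := by exact_mod_cast ne_of_sq_eq_two hs (-1)
  have e1 : (s + 1) ^ 2 = 3 + 2 * s := by linear_combination hs
  have e2 : (s - 1) ^ 2 = 3 - 2 * s := by linear_combination hs
  -- A coincidence of squares would make `s` equal to 0, 1 or -1, contradicting its irrationality.
  have hinj : Function.Injective fun i => (![1, s + 1, s - 1] : Fin 3 → ℂ) i ^ 2 := by
    intro i j hij
    fin_cases i <;> fin_cases j <;> simp [e1, e2] at hij ⊢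
    · exact hm1 (by linear_combination -hij / 2)
    · exact hp1 (by linear_combination hij / 2)
    · exact hm1 (by linear_combination hij / 2)
    · exact hs0 (by linear_combination hij / 4)
    · exact hp1 (by linear_combination -hij / 2)
    · exact hs0 (by linear_combination -hij / 4)
  have := card_lines_le two_pos hζ hV0 hVζ ![1, s + 1, s - 1] ![r, 1, 1]
    (by
      intro i
      fin_cases i
      · exact one_ne_zero
      · exact fun h => hm1 (eq_neg_of_add_eq_zero_left h)
      · exact fun h => hp1 (sub_eq_zero.mp h))
    hinj
    (by
      intro i
      fin_cases i
      · exact h1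
      · simpa using h3
      · simpa using h5)
    hy (lineForm_zero_dvd hs hV h2)
  simp only [Fin.sum_univ_three, Matrix.cons_val] at this
  omega

/-- The orbit of `y` consists of `y`, `x` and the four lines with root a power of `i`. The twelve
mirror lines form three diagonal orbits of size four, with representatives `s + 1`, `s - 1` and `s
(1 - i) / 2`. On the octahedron these are the six vertices and twelve edge midpoints. -/
theorem lines_typeII (hs : s ^ 2 = 2) (hV0 : V ≠ 0) (hV : substHom (reflection s) V = -V)
    (hVζ : substHom (scaleY Complex.I) V ∣ V) (hy : y ^ r ∣ V) :
    12 + (1 + 4 + 1) * r ≤ V.totalDegree := by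
  have hI := Complex.I_sq
  have hs0 : s ≠ 0 := by exact_mod_cast ne_of_sq_eq_two hs 0
  have hp1 : s ≠ 1 := by exact_mod_cast ne_of_sq_eq_two hs 1
  have hm1 : s ≠ -1 := by exact_mod_cast ne_of_sq_eq_two hs (-1)
  have h1 := lineForm_one_dvd hV hy
  have h2 : lineForm (-1) ^ r ∣ V := by simpa using lineForm_mul_pow_dvd hVζ h1 2
  have h3 := mirror_dvd hs0 hV
  have h4 : lineForm (-(s + 1)) ∣ V := by
    have := lineForm_mul_pow_dvd hVζ (r := 1) (by rwa [pow_one]) 2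
    rwa [pow_one, Complex.I_sq, mul_neg_one] at this
  have h5 := conjugate_mirror_dvd hs hV h4
  have h6 : lineForm ((s + 1) * Complex.I) ^ 1 ∣ V := by
    simpa using lineForm_mul_pow_dvd hVζ (r := 1) (by simpa using h3) 1
  have h7 : lineForm (s * (1 - Complex.I) / 2) ^ 1 ∣ V := by
    refine lineForm_dvd_of_lineForm_dvd hV (fun h => ?_) ?_ h6
    -- Root 1 would force `s = -1 - i`, whose square is purely imaginary, not 2.
    · have hsI : s = -Complex.I - 1 := by linear_combination -Complex.I * h + (s + 1) * hI
      rw [hsI] at hs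
      have := congrArg Complex.re hs
      simp [pow_two] at this
    · linear_combination ((1 - Complex.I) * Complex.I / 2 - 1) * hs - (s / 2 + 1) * hI
  have e1 : (s + 1) ^ 4 = 17 + 12 * s := by linear_combination (s ^ 2 + 4 * s + 8) * hs
  have e2 : (s - 1) ^ 4 = 17 - 12 * s := by linear_combination (s ^ 2 - 4 * s + 8) * hs
  have e3 : (s * (1 - Complex.I) / 2) ^ 4 = -1 := by
    have : (1 - Complex.I) ^ 4 = -4 := by
      linear_combination (Complex.I ^ 2 - 4 * Complex.I + 5) * hI
    rw [div_pow, mul_pow, this]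
    linear_combination -(s ^ 2 + 2) / 4 * hs
  have hinj : Function.Injective fun i =>
      (![1, s + 1, s - 1, s * (1 - Complex.I) / 2] : Fin 4 → ℂ) i ^ 4 := by
    intro i j hij
    fin_cases i <;> fin_cases j <;> simp [e1, e2, e3] at hij ⊢
    · exact ne_of_sq_eq_two hs (-4 / 3) (by push_cast; linear_combination -hij / 12)
    · exact ne_of_sq_eq_two hs (4 / 3) (by push_cast; linear_combination hij / 12)
    · norm_num at hij
    · exact ne_of_sq_eq_two hs (-4 / 3) (by push_cast; linear_combination hij / 12)
    · exact hs0 (by linear_combination hij / 24)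
    · exact ne_of_sq_eq_two hs (-3 / 2) (by push_cast; linear_combination hij / 12)
    · exact ne_of_sq_eq_two hs (4 / 3) (by push_cast; linear_combination -hij / 12)
    · exact hs0 (by linear_combination -hij / 24)
    · exact ne_of_sq_eq_two hs (3 / 2) (by push_cast; linear_combination -hij / 12)
    · norm_num at hij
    · exact ne_of_sq_eq_two hs (-3 / 2) (by push_cast; linear_combination -hij / 12)
    · exact ne_of_sq_eq_two hs (3 / 2) (by push_cast; linear_combination hij / 12)
  have := card_lines_le four_pos Complex.isPrimitiveRoot_I hV0 hVζ
    ![1, s + 1, s - 1, s * (1 - Complex.I) / 2] ![r, 1, 1, 1]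
    (by
      intro i
      fin_cases i
      · exact one_ne_zero
      · exact fun h => hm1 (eq_neg_of_add_eq_zero_left h)
      · exact fun h => hp1 (sub_eq_zero.mp h)
      · intro h
        change s * (1 - Complex.I) / 2 = 0 at h
        rw [h] at e3
        norm_num at e3)
    hinj
    (by
      intro i
      fin_cases i
      · exact h1
      · simpa using h3
      · simpa using h5
      · exact h7)
    hy (lineForm_zero_dvd hs hV h2)
  simp only [Fin.sum_univ_four, Matrix.cons_val] at this
  omega

/-- The tetrahedral case: four lines `y`, `x - ω ^ j y`, and six mirror lines with roots `(s + 1) ω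
^ j` and `(1 - s) ω ^ j`. -/
theorem lines_typeIII {ω : ℂ} (hω : IsPrimitiveRoot ω 3) (hs : s ^ 2 = 3) (hV0 : V ≠ 0)
    (hV : substHom (reflection s) V = -V) (hVζ : substHom (scaleY ω) V ∣ V) (hy : y ^ r ∣ V) :
    6 + (0 + 3 + 1) * r ≤ V.totalDegree := by
  have hω3 := hω.pow_eq_one
  have hω2 : ω ^ 2 + ω + 1 = 0 := by
    have h1 : ω - 1 ≠ 0 := sub_ne_zero.mpr (hω.ne_one (by norm_num))
    apply mul_left_cancel₀ h1
    linear_combination hω3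
  have key : ∀ q : ℚ, q ^ 2 ≠ 3 → s ≠ q := by
    rintro q hq rfl
    exact hq (by exact_mod_cast hs)
  have hs0 : s ≠ 0 := by exact_mod_cast key 0 (by norm_num)
  have hp1 : s ≠ 1 := by exact_mod_cast key 1 (by norm_num)
  have hm1 : s ≠ -1 := by exact_mod_cast key (-1) (by norm_num)
  have h1 := lineForm_one_dvd hV hy
  have h3 := mirror_dvd hs0 hV
  have h6 : lineForm ((s + 1) * ω) ^ 1 ∣ V := by
    simpa using lineForm_mul_pow_dvd hVζ (r := 1) (by simpa using h3) 1
  have h7 : lineForm ((1 - s) * ω) ^ 1 ∣ V := by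
    refine lineForm_dvd_of_lineForm_dvd hV (fun h => ?_) ?_ h6
    · have h8 := congrArg (· ^ 3) h
      simp only [mul_pow, hω3] at h8
      exact key (-9 / 6) (by norm_num)
        (by push_cast; linear_combination h8 / 6 - (s + 3) / 6 * hs)
    · linear_combination (-ω ^ 2 - 1) * hs - 2 * hω2
  have e1 : (s + 1) ^ 3 = 10 + 6 * s := by linear_combination (s + 3) * hs
  have e2 : ((1 - s) * ω) ^ 3 = 10 - 6 * s := by
    rw [mul_pow, hω3]
    linear_combination (3 - s) * hs
  have hinj : Function.Injective fun i =>
      (![1, s + 1, (1 - s) * ω] : Fin 3 → ℂ) i ^ 3 := by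
    intro i j hij
    fin_cases i <;> fin_cases j <;> simp [e1, e2] at hij ⊢
    · exact key (-3 / 2) (by norm_num) (by push_cast; linear_combination -hij / 6)
    · exact key (3 / 2) (by norm_num) (by push_cast; linear_combination hij / 6)
    · exact key (-3 / 2) (by norm_num) (by push_cast; linear_combination hij / 6)
    · exact hs0 (by linear_combination hij / 12)
    · exact key (3 / 2) (by norm_num) (by push_cast; linear_combination -hij / 6)
    · exact hs0 (by linear_combination -hij / 12)
  have := card_lines_le three_pos hω hV0 hVζ ![1, s + 1, (1 - s) * ω] ![r, 1, 1]
    (by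
      intro i
      fin_cases i
      · exact one_ne_zero
      · exact fun h => hm1 (eq_neg_of_add_eq_zero_left h)
      · exact mul_ne_zero (sub_ne_zero.mpr hp1.symm) (hω.ne_zero (by norm_num)))
    hinj
    (by
      intro i
      fin_cases i
      · exact h1
      · simpa using h3
      · exact h7)
    -- The line `x` lies in neither orbit, so it contributes nothing.
    hy (b := 0) (by simp)
  simp only [Fin.sum_univ_three, Matrix.cons_val] at this
  omega

/-- The orbit of `y` is `y`, `x ± y`, and the mirror orbit is `x ± 3 y` together with `x`; here `x`
is a mirror line, so it counts once and not `r` times. -/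
theorem lines_typeIV (hV0 : V ≠ 0) (hV : substHom (reflection 2) V = -V)
    (hVζ : substHom (scaleY (-1)) V ∣ V) (hy : y ^ r ∣ V) :
    3 + (0 + 2 + 1) * r ≤ V.totalDegree := by
  have hζ : IsPrimitiveRoot (-1 : ℂ) 2 := IsPrimitiveRoot.neg_one 0 (by norm_num)
  have h3 : lineForm 3 ^ 1 ∣ V := by
    have := mirror_dvd two_ne_zero hV
    rw [pow_one]
    convert this using 2
    norm_num
  have h4 : lineForm (-3) ^ 1 ∣ V := by simpa using lineForm_mul_pow_dvd hVζ h3 1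
  have h5 : lineForm 0 ^ 1 ∣ V :=
    lineForm_dvd_of_lineForm_dvd hV (by norm_num) (by norm_num) h4
  have := card_lines_le two_pos hζ hV0 hVζ ![1, 3] ![r, 1]
    (by intro i; fin_cases i <;> simp)
    (by
      intro i j hij
      fin_cases i <;> fin_cases j <;> simp at hij ⊢ <;> norm_num at hij)
    (by
      intro i
      fin_cases i
      · exact lineForm_one_dvd hV hy
      · exact h3)
    hy h5
  simp only [Fin.sum_univ_two, Matrix.cons_val] at this
  omega

end Lines

/-! ### Diagonal invariance and the final bounds -/

theorem substHom_eq_self_of_mem_adjoin {σ : Matrix (Fin 2) (Fin 2) ℂ} {f g W : Poly}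
    (hf : substHom σ f = f) (hg : substHom σ g = g) (hW : W ∈ Algebra.adjoin ℂ {f, g}) :
    substHom σ W = W := by
  have h : Algebra.adjoin ℂ {f, g} ≤ AlgHom.equalizer (substHom σ) (AlgHom.id ℂ Poly) := by
    rw [Algebra.adjoin_le_iff]
    rintro p (rfl | rfl)
    · exact hf
    · exact hg
  exact h hW

theorem substHom_scaleY_x (ζ : ℂ) : substHom (scaleY ζ) (X 0) = x := by simp [scaleY]

theorem substHom_scaleY_y (ζ : ℂ) : substHom (scaleY ζ) (X 1) = C ζ * y := by simp [scaleY]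

/-- Provides the condition `d + e ≤ n` of `degree_bound` for the two symbols with `e = 1`; for `e =
0` it is just `d ≤ n`. -/
theorem add_lt_of_dvd_of_substHom_eq_neg {s : ℂ} (hs : s ^ 2 = 2) {W : Poly} {n d : ℕ}
    (hform : HasForm W n d) (hW : substHom (reflection s) W = -W) (hd : 2 ∣ d) : d + 1 ≤ n := by
  obtain h | rfl := lt_or_eq_of_le hform.2.1
  · exact h
  · obtain ⟨m, rfl⟩ := hd
    exact absurd hW (not_substHom_eq_neg hs hform)

/-- The real floor bound follows from a bound on the quotient `d / k`. -/
theorem le_floor_of_degree_bound {n d k M N : ℕ} (hN : 0 < N) (hkd : k ∣ d)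
    (h : M + N * (d / k - 1) ≤ n) (hd : 1 ≤ d) (hk : 0 < k) :
    (d : ℤ) ≤ k * ⌊((n : ℝ) - M) / N⌋ + k := by
  obtain ⟨t, rfl⟩ := hkd
  rw [Nat.mul_div_cancel_left _ hk] at h
  obtain ⟨u, rfl⟩ : ∃ u, t = u + 1 := ⟨t - 1, by
    have : t ≠ 0 := by rintro rfl; simp at hd
    omega⟩
  have hu : (u : ℤ) ≤ ⌊((n : ℝ) - M) / N⌋ := by
    rw [Int.le_floor, le_div_iff₀ (by exact_mod_cast hN)]
    have : ((M + N * u : ℕ) : ℝ) ≤ n := by exact_mod_cast h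
    push_cast at this ⊢
    linarith
  have := mul_le_mul_of_nonneg_left hu (Int.natCast_nonneg k)
  push_cast
  linarith

theorem sq_sqrt_ofReal {q : ℝ} (hq : 0 ≤ q) : (Real.sqrt q : ℂ) ^ 2 = q := by
  rw [← Complex.ofReal_pow, Real.sq_sqrt hq]

theorem IsTypeI.bound {W : Poly} {n d : ℕ} (h : IsTypeI W n d) :
    (d : ℤ) ≤ 2 * ⌊((n : ℝ) - 4) / 8⌋ + 2 := by
  obtain ⟨⟨hform, hσ⟩, hmem⟩ := h
  rw [subst_eq_substHom, macWilliams_eq_reflection zero_le_two] at hσ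
  have hs : (Real.sqrt 2 : ℂ) ^ 2 = 2 := by simpa using sq_sqrt_ofReal zero_le_two
  have hζ : IsPrimitiveRoot (-1 : ℂ) 2 := IsPrimitiveRoot.neg_one 0 (by norm_num)
  have hWζ : substHom (scaleY (-1)) W = W := by
    refine substHom_eq_self_of_mem_adjoin ?_ ?_ hmem
    · simp only [W₂, map_add, map_mul, map_pow, substHom_scaleY_x, substHom_scaleY_y, substHom_C,
        C_neg, C_1]
      ring
    · simp only [phi₄, map_add, map_sub, map_mul, map_pow, map_ofNat, substHom_scaleY_x,
        substHom_scaleY_y, C_neg, C_1]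
      ring
  have hkd := hform.dvd_of_scaleY hζ hWζ
  have := degree_bound two_pos hζ (symbol_one_two _ hs)
    (fun V r hV0 hV hVζ hy => lines_typeI hs hV0 hV hVζ hy) hform hσ hWζ
    (add_lt_of_dvd_of_substHom_eq_neg hs hform hσ hkd)
  -- Here and in the other types `N = k (e + k + 1)`: since `k ∣ d`, the term `(e + k + 1)(d - k)`
  -- equals `N (d / k - 1)`.
  exact_mod_cast le_floor_of_degree_bound (M := 4) (N := 8) (by norm_num) hkd (by omega) hform.1
    two_pos

theorem IsTypeII.bound {W : Poly} {n d : ℕ} (h : IsTypeII W n d) :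
    (d : ℤ) ≤ 4 * ⌊((n : ℝ) - 12) / 24⌋ + 4 := by
  obtain ⟨⟨hform, hσ⟩, hmem⟩ := h
  rw [subst_eq_substHom, macWilliams_eq_reflection zero_le_two] at hσ
  have hs : (Real.sqrt 2 : ℂ) ^ 2 = 2 := by simpa using sq_sqrt_ofReal zero_le_two
  have hζ := Complex.isPrimitiveRoot_I
  have hI4 : (C Complex.I : Poly) ^ 4 = 1 := by rw [← C_pow, Complex.I_pow_four, C_1]
  have hWζ : substHom (scaleY Complex.I) W = W := by
    refine substHom_eq_self_of_mem_adjoin ?_ ?_ hmem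
    · simp only [WH₈, map_add, map_mul, map_pow, map_ofNat, substHom_scaleY_x, substHom_scaleY_y]
      linear_combination (14 * x ^ 4 * y ^ 4 + y ^ 8 * (C Complex.I ^ 4 + 1)) * hI4
    · simp only [W₁₂, map_add, map_sub, map_mul, map_pow, map_ofNat, substHom_scaleY_x,
        substHom_scaleY_y]
      linear_combination (-33 * x ^ 8 * y ^ 4 - 33 * x ^ 4 * y ^ 8 * (C Complex.I ^ 4 + 1) +
        y ^ 12 * (C Complex.I ^ 8 + C Complex.I ^ 4 + 1)) * hI4
  have hkd := hform.dvd_of_scaleY hζ hWζ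
  have := degree_bound four_pos hζ (symbol_one_four _ hs)
    (fun V r hV0 hV hVζ hy => lines_typeII hs hV0 hV hVζ hy) hform hσ hWζ
    (add_lt_of_dvd_of_substHom_eq_neg hs hform hσ ((by norm_num : 2 ∣ 4).trans hkd))
  exact_mod_cast le_floor_of_degree_bound (M := 12) (N := 24) (by norm_num) hkd (by omega)
    hform.1 four_pos

theorem IsTypeIII.bound {W : Poly} {n d : ℕ} (h : IsTypeIII W n d) :
    (d : ℤ) ≤ 3 * ⌊((n : ℝ) - 6) / 12⌋ + 3 := by
  obtain ⟨⟨hform, hσ⟩, hmem⟩ := h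
  rw [subst_eq_substHom, macWilliams_eq_reflection zero_le_three] at hσ
  have hs : (Real.sqrt 3 : ℂ) ^ 2 = 3 := by simpa using sq_sqrt_ofReal zero_le_three
  obtain ⟨ω, hω⟩ : ∃ ω : ℂ, IsPrimitiveRoot ω 3 := ⟨_, Complex.isPrimitiveRoot_exp 3 (by norm_num)⟩
  have hω3 : (C ω : Poly) ^ 3 = 1 := by rw [← C_pow, hω.pow_eq_one, C_1]
  have hWζ : substHom (scaleY ω) W = W := by
    refine substHom_eq_self_of_mem_adjoin ?_ ?_ hmem
    · simp only [W₄, map_add, map_mul, map_pow, map_ofNat, substHom_scaleY_x, substHom_scaleY_y]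
      linear_combination 8 * x * y ^ 3 * hω3
    · simp only [psi₆, map_sub, map_mul, map_pow, map_ofNat, substHom_scaleY_x,
        substHom_scaleY_y]
      linear_combination (-20 * x ^ 3 * y ^ 3 - 8 * y ^ 6 * (C ω ^ 3 + 1)) * hω3
  have hkd := hform.dvd_of_scaleY hω hWζ
  have := degree_bound three_pos hω (symbol_zero_three _ hs)
    (fun V r hV0 hV hVζ hy => lines_typeIII hω hs hV0 hV hVζ hy) hform hσ hWζ hform.2.1
  exact_mod_cast le_floor_of_degree_bound (M := 6) (N := 12) (by norm_num) hkd (by omega)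
    hform.1 three_pos

theorem IsTypeIV.bound {W : Poly} {n d : ℕ} (h : IsTypeIV W n d) :
    (d : ℤ) ≤ 2 * ⌊((n : ℝ) - 3) / 6⌋ + 2 := by
  obtain ⟨⟨hform, hσ⟩, hmem⟩ := h
  have hsqrt : Real.sqrt 4 = 2 := by
    rw [show (4 : ℝ) = 2 ^ 2 by norm_num, Real.sqrt_sq zero_le_two]
  rw [subst_eq_substHom, macWilliams_eq_reflection zero_le_four, hsqrt, Complex.ofReal_ofNat] at hσ
  have hζ : IsPrimitiveRoot (-1 : ℂ) 2 := IsPrimitiveRoot.neg_one 0 (by norm_num)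
  have hWζ : substHom (scaleY (-1)) W = W := by
    refine substHom_eq_self_of_mem_adjoin ?_ ?_ hmem
    · simp only [W₂, map_add, map_mul, map_pow, substHom_scaleY_x, substHom_scaleY_y, substHom_C,
        C_neg, C_1]
      ring
    · simp only [phi₃, map_sub, map_mul, map_pow, map_ofNat, substHom_scaleY_x,
        substHom_scaleY_y, C_neg, C_1]
      ring
  have hkd := hform.dvd_of_scaleY hζ hWζ
  have := degree_bound two_pos hζ symbol_zero_two
    (fun V r hV0 hV hVζ hy => lines_typeIV hV0 hV hVζ hy) hform hσ hWζ hform.2.1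
  exact_mod_cast le_floor_of_degree_bound (M := 3) (N := 6) (by norm_num) hkd (by omega) hform.1
    two_pos

end FormalWeight

theorem theorem1p1 :
    (∀ (W : FormalWeight.Poly) (n d : ℕ), FormalWeight.IsTypeI W n d →
      (d : ℤ) ≤ 2 * ⌊((n : ℝ) - 4) / 8⌋ + 2) ∧
    (∀ (W : FormalWeight.Poly) (n d : ℕ), FormalWeight.IsTypeII W n d →
      (d : ℤ) ≤ 4 * ⌊((n : ℝ) - 12) / 24⌋ + 4) ∧
    (∀ (W : FormalWeight.Poly) (n d : ℕ), FormalWeight.IsTypeIII W n d →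
      (d : ℤ) ≤ 3 * ⌊((n : ℝ) - 6) / 12⌋ + 3) ∧
    (∀ (W : FormalWeight.Poly) (n d : ℕ), FormalWeight.IsTypeIV W n d →
      (d : ℤ) ≤ 2 * ⌊((n : ℝ) - 3) / 6⌋ + 2) :=
  ⟨fun _ _ _ h => h.bound, fun _ _ _ h => h.bound, fun _ _ _ h => h.bound,
    fun _ _ _ h => h.bound⟩
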